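/- Let $\mathcal H$ be a real Hilbert space, $\mathcal G$ a real normed space, and $\mathcal D\subset\mathcal G$ a subset with the induced topology. Let $I=I_1\sqcup I_2$ be a finite index set and let $f_i:\mathcal D\to\mathbb R$, $g_i:\mathcal D\to\mathcal H$, $i\in I$, be locally Lipschitz on $\mathcal D$. For $p\in\mathcal D$ put $$C(p)=\{x\in\mathcal H:\ \langle x, g_i(p)\rangle=f_i(p)\ (i\in I_1),\ \ \langle x, g_i(p)\rangle\le f_i(p)\ (i\in I_2)\},$$ and, when $C(p)\ne\emptyset$, let $P(v,p)$ denote the metric projection of $v\in\mathcal H$ onto $C(p)$. For $x\in\mathcal H$ let $I_p(x)=\{i\in I:\langle x,g_i(p)\rangle=f_i(p)\}$. Let $\bar p\in\mathcal D$, $\bar x\in C(\bar p)$, $\bar v\in\mathcal H$, and assume: 1. (RCRCQ, the relaxed constant rank constraint qualification, at $(\bar p,\bar x)$) there is a neighbourhood $U_0$ of $\bar p$ in $\mathcal D$ such that for every $J$ with $I_1\subset J\subset I_{\bar p}(\bar x)$ and every $p\in U_0$, $\operatorname{rank}\{g_i(p):i\in J\}=\operatorname{rank}\{g_i(\bar p):i\in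 J\}$; 2. $\bar x$ belongs to the lower Kuratowski limit $\liminf_{p\to\bar p,\,p\in\mathcal D}C(p)$, that is, for every neighbourhood $V$ of $\bar x$ there is a neighbourhood $U'$ of $\bar p$ in $\mathcal D$ such that $V\cap C(p)\neq\emptyset$ for all $p\in U'$. Then there exist a constant $\ell^0>0$ and neighbourhoods $W$ of $\bar v$ in $\mathcal H$ and $U$ of $\bar p$ in $\mathcal D$ such that $C(p)\neq\emptyset$ for all $p\in U$ (so that $P$ is well defined on $W\times U$), and $$\|(v_1-v_2)-2[P(v_1,p_1)-P(v_2,p_2)]\|\le\|v_1-v_2\|+\ell^0\|p_1-p_2\|^{1/2}$$ for all $(v_1,p_1),(v_2,p_2)\in W\times U$. -/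

import Mathlib

open scoped Topology

/-- The feasible set `C(p)` of the parametric linear system with finitely many constraints indexed
by `ι`: equalities for `i ∈ I₁`, inequalities for the remaining indices (so `I₂ = I₁ᶜ`). -/
def feasibleSet {ι H D : Type*} [NormedAddCommGroup H] [InnerProductSpace ℝ H]
    (I₁ : Set ι) (f : ι → D → ℝ) (g : ι → D → H) (p : D) : Set H :=
  {x | (∀ i ∈ I₁, inner ℝ x (g i p) = f i p) ∧ (∀ i ∉ I₁, inner ℝ x (g i p) ≤ f i p)}

/-- The active index set `I_p(x)`. -/
def activeSet {ι H D : Type*} [NormedAddCommGroup H] [InnerProductSpace ℝ H]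
    (f : ι → D → ℝ) (g : ι → D → H) (p : D) (x : H) : Set ι :=
  {i | inner ℝ x (g i p) = f i p}

/-- The relaxed constant rank constraint qualification at `(pbar, xbar)`. -/
def RCRCQ {ι H D : Type*} [NormedAddCommGroup H] [InnerProductSpace ℝ H] [TopologicalSpace D]
    (I₁ : Set ι) (f : ι → D → ℝ) (g : ι → D → H) (pbar : D) (xbar : H) : Prop :=
  ∃ U ∈ 𝓝 pbar, ∀ J : Set ι, I₁ ⊆ J → J ⊆ activeSet f g pbar xbar →
    ∀ p ∈ U, Set.finrank ℝ ((fun i => g i p) '' J) = Set.finrank ℝ ((fun i => g i pbar) '' J)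

/-- The lower Kuratowski limit of a multifunction `F` at `pbar`. -/
def lowerKuratowskiLimit {D H : Type*} [TopologicalSpace D] [TopologicalSpace H]
    (F : D → Set H) (pbar : D) : Set H :=
  {x | ∀ V ∈ 𝓝 x, ∃ U ∈ 𝓝 pbar, ∀ p ∈ U, (V ∩ F p).Nonempty}

/-- `x` is a metric projection of `v` onto `S`. -/
def IsProjection {H : Type*} [NormedAddCommGroup H] (S : Set H) (v x : H) : Prop :=
  x ∈ S ∧ ∀ y ∈ S, ‖x - v‖ ≤ ‖y - v‖

open Classical in
/-- The metric projection of `v` onto `S`, a point of `S` nearest to `v` (the value is `0` if there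
is no such point). -/
noncomputable def metricProjection {H : Type*} [NormedAddCommGroup H] (S : Set H) (v : H) : H :=
  if h : ∃ x, IsProjection S v x then h.choose else 0

/-- On a nonempty set `C(p)` in a Hilbert space, the projection exists, is unique, and is the value
of `metricProjection`. -/
theorem isProjection_feasibleSet_iff {ι H D : Type*} [NormedAddCommGroup H]
    [InnerProductSpace ℝ H] [CompleteSpace H] (I₁ : Set ι) (f : ι → D → ℝ) (g : ι → D → H)
    (p : D) (hne : (feasibleSet I₁ f g p).Nonempty) (v x : H) :
    IsProjection (feasibleSet I₁ f g p) v x ↔ x = metricProjection (feasibleSet I₁ f g p) v := by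
  set S := feasibleSet I₁ f g p with hS
  have hconv : Convex ℝ S := by
    intro a ha b hb s t hs ht hst
    have hin : ∀ i, inner ℝ (s • a + t • b) (g i p)
        = s * inner ℝ a (g i p) + t * inner ℝ b (g i p) := by
      intro i
      rw [inner_add_left, real_inner_smul_left, real_inner_smul_left]
    refine ⟨fun i hi => ?_, fun i hi => ?_⟩
    · rw [hin, ha.1 i hi, hb.1 i hi, ← add_mul, hst, one_mul]
    · have h1 := mul_le_mul_of_nonneg_left (ha.2 i hi) hs
      have h2 := mul_le_mul_of_nonneg_left (hb.2 i hi) ht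
      have h3 : s * f i p + t * f i p = f i p := by rw [← add_mul, hst, one_mul]
      rw [hin]
      linarith
  have hclosed : IsClosed S := by
    have hE : S = (⋂ i ∈ I₁, {x : H | inner ℝ x (g i p) = f i p}) ∩
        (⋂ i ∈ I₁ᶜ, {x : H | inner ℝ x (g i p) ≤ f i p}) := by
      ext y
      simp [hS, feasibleSet]
    rw [hE]
    exact (isClosed_biInter fun i _ => isClosed_eq (by fun_prop) continuous_const).inter
      (isClosed_biInter fun i _ => isClosed_le (by fun_prop) continuous_const)
  have hchar : ∀ y, IsProjection S v y → ∀ w ∈ S, inner ℝ (v - y) (w - y) ≤ 0 := by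
    intro y hy
    have : Nonempty S := hne.to_subtype
    refine (norm_eq_iInf_iff_real_inner_le_zero hconv hy.1).1 (le_antisymm ?_ ?_)
    · refine le_ciInf fun w => ?_
      rw [norm_sub_rev v y, norm_sub_rev v w]
      exact hy.2 w w.2
    · exact ciInf_le ⟨0, by rintro _ ⟨w, rfl⟩; exact norm_nonneg _⟩ (⟨y, hy.1⟩ : S)
  have huniq : ∀ y z, IsProjection S v y → IsProjection S v z → y = z := by
    intro y z hy hz
    have h1 := hchar y hy z hz.1
    have h2 := hchar z hz y hy.1
    have h3 : inner ℝ (v - y) (z - y) + inner ℝ (v - z) (y - z) = ‖y - z‖ ^ 2 := by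
      rw [← real_inner_self_eq_norm_sq]
      simp only [inner_sub_left, inner_sub_right]
      ring
    have h4 : ‖y - z‖ = 0 := by
      have : ‖y - z‖ ^ 2 ≤ 0 := by linarith
      exact pow_eq_zero_iff (two_ne_zero) |>.1 (le_antisymm this (sq_nonneg _))
    exact sub_eq_zero.1 (norm_eq_zero.1 h4)
  have hex : ∃ y, IsProjection S v y := by
    obtain ⟨y, hyS, hy⟩ := exists_norm_eq_iInf_of_complete_convex hne hclosed.isComplete hconv v
    refine ⟨y, hyS, fun w hw => ?_⟩
    rw [norm_sub_rev y v, norm_sub_rev w v, hy]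
    exact ciInf_le ⟨0, by rintro _ ⟨w, rfl⟩; exact norm_nonneg _⟩ (⟨w, hw⟩ : S)
  have hval : IsProjection S v (metricProjection S v) := by
    rw [metricProjection, dif_pos hex]
    exact hex.choose_spec
  exact ⟨fun hx => huniq _ _ hx hval, fun hx => hx ▸ hval⟩

/-- The solution map `P(v, p)`: the projection of `v` onto `C(p)`. -/
noncomputable def projMap {ι H D : Type*} [NormedAddCommGroup H] [InnerProductSpace ℝ H]
    (I₁ : Set ι) (f : ι → D → ℝ) (g : ι → D → H) (v : H) (p : D) : H :=
  metricProjection (feasibleSet I₁ f g p) v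

/-! For a fixed closed convex set, firm nonexpansiveness of the projection makes `v ↦ v - 2 P v`
nonexpansive. If instead each of two projections lies within `η` of the other set, testing the
variational inequalities at those nearby points costs an error of order `η` in the squared norm
(`norm_sub_two_smul_sub_sq_le`). With `η` proportional to `‖p₁ - p₂‖`, the square root produces the
exponent 1/2. It remains to see that `C(·)` is Lipschitz on bounded sets near `pbar`
(`exists_lipschitz_feasibleSet`). For the constraints active at `xbar` this is Hoffman's error
bound. Its constant is governed by the coefficients of linearly independent subfamilies, and
constant rank ensures that only subfamilies already independent at `pbar` occur, so the constant is
uniform in `p` (`exists_eventually_hoffman`). Constraints inactive at `xbar` are repaired by moving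
slightly towards a point of `C(p)` near `xbar`, which the lower limit provides and where those
constraints have slack. -/

theorem convex_feasibleSet {ι H D : Type*} [NormedAddCommGroup H] [InnerProductSpace ℝ H]
    (E : Set ι) (f : ι → D → ℝ) (g : ι → D → H) (p : D) : Convex ℝ (feasibleSet E f g p) := by
  intro u hu w hw s t hs ht hst
  have hin : ∀ i, inner ℝ (s • u + t • w) (g i p)
      = s * inner ℝ u (g i p) + t * inner ℝ w (g i p) := by
    intro i
    rw [inner_add_left, real_inner_smul_left, real_inner_smul_left]
  have hf : ∀ i, s * f i p + t * f i p = f i p := fun i => by rw [← add_mul, hst, one_mul]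
  refine ⟨fun i hi => ?_, fun i hi => ?_⟩
  · rw [hin, hu.1 i hi, hw.1 i hi, hf]
  · rw [hin, ← hf i]
    exact add_le_add (mul_le_mul_of_nonneg_left (hu.2 i hi) hs)
      (mul_le_mul_of_nonneg_left (hw.2 i hi) ht)

/-- The variational inequality for the projection onto a feasible set. -/
theorem inner_sub_le_zero_of_isProjection {ι H D : Type*} [NormedAddCommGroup H]
    [InnerProductSpace ℝ H] {E : Set ι} {f : ι → D → ℝ} {g : ι → D → H} {p : D} {v y : H}
    (hy : IsProjection (feasibleSet E f g p) v y) {w : H} (hw : w ∈ feasibleSet E f g p) :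
    inner ℝ (v - y) (w - y) ≤ 0 := by
  have : Nonempty (feasibleSet E f g p) := ⟨⟨y, hy.1⟩⟩
  refine (norm_eq_iInf_iff_real_inner_le_zero (convex_feasibleSet E f g p) hy.1).1
    (le_antisymm ?_ ?_) w hw
  · refine le_ciInf fun u => ?_
    rw [norm_sub_rev v y, norm_sub_rev v u]
    exact hy.2 u u.2
  · exact ciInf_le (f := fun u : feasibleSet E f g p => ‖v - u‖)
      ⟨0, by rintro _ ⟨u, rfl⟩; exact norm_nonneg _⟩ ⟨y, hy.1⟩

/-! ### Finitely generated cones, Farkas' lemma and Hoffman's error bound. -/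

section ConicCombinations

variable {ι H : Type*} [Fintype ι]

theorem linearIndepOn_iff_forall_sum [AddCommGroup H] [Module ℝ H] {a : ι → H} {S : Set ι} :
    LinearIndepOn ℝ a S ↔
      ∀ l : ι → ℝ, (∀ i ∉ S, l i = 0) → ∑ i, l i • a i = 0 → l = 0 := by
  classical
  rw [linearIndepOn_iff]
  constructor
  · intro h l hl hsum
    have h1 := h (Finsupp.equivFunOnFinite.symm l) (by
      rw [Finsupp.mem_supported]
      intro i hi
      by_contra hiS
      simp [hl i hiS] at hi) (by
      rw [Finsupp.linearCombination_apply, Finsupp.sum_fintype _ _ (by simp)]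
      simpa using hsum)
    ext i
    simpa using DFunLike.congr_fun h1 i
  · intro h l hl hsum
    rw [Finsupp.mem_supported] at hl
    rw [Finsupp.linearCombination_apply, Finsupp.sum_fintype _ _ (by simp)] at hsum
    have h1 := h l (fun i hi => by
      by_contra h0
      exact hi (hl (by simpa using h0))) hsum
    ext i
    exact congrFun h1 i

/-- The conic combinations of the vectors `a i`, `i ∈ T`, in which the coefficients of the vectors
with index in `E` may have any sign. -/
def conicSet [AddCommGroup H] [Module ℝ H] (a : ι → H) (E T : Set ι) : Set H :=
  {z | ∃ l : ι → ℝ, (∀ i ∉ T, l i = 0) ∧ (∀ i ∉ E, 0 ≤ l i) ∧ ∑ i, l i • a i = z}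

/-- Carathéodory's reduction for conic combinations with free coefficients on `E`. -/
theorem exists_linearIndepOn_conic [AddCommGroup H] [Module ℝ H] (a : ι → H) {E T : Set ι}
    (hET : E ⊆ T) (hE : LinearIndepOn ℝ a E) {z : H} (hz : z ∈ conicSet a E T) :
    ∃ S, E ⊆ S ∧ S ⊆ T ∧ LinearIndepOn ℝ a S ∧ z ∈ conicSet a E S := by
  classical
  induction hn : T.ncard using Nat.strong_induction_on generalizing T with
  | _ n ih =>
  by_cases hT : LinearIndepOn ℝ a T
  · exact ⟨T, hET, subset_rfl, hT, hz⟩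
  obtain ⟨l, hlT, hlE, rfl⟩ := hz
  -- it suffices to remove one index
  suffices h : ∃ k ∈ T, k ∉ E ∧ ∑ i, l i • a i ∈ conicSet a E (T \ {k}) by
    obtain ⟨k, hkT, hkE, hk⟩ := h
    have hsub : E ⊆ T \ {k} := fun i hi => ⟨hET hi, fun h => hkE (h ▸ hi)⟩
    obtain ⟨S, h1, h2, h3, h4⟩ := ih _ (by
      rw [← hn]
      exact Set.ncard_lt_ncard (Set.sdiff_singleton_ssubset.2 hkT)) hsub hk rfl
    exact ⟨S, h1, h2.trans Set.sdiff_subset, h3, h4⟩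
  -- Independence on `E` forces any dependency on `T` to involve an index outside `E`; flipping its
  -- sign makes that coefficient positive.
  obtain ⟨m, hmT, hmsum, k₀, hk₀E, hk₀⟩ : ∃ m : ι → ℝ, (∀ i ∉ T, m i = 0) ∧
      ∑ i, m i • a i = 0 ∧ ∃ k, k ∉ E ∧ 0 < m k := by
    rw [linearIndepOn_iff_forall_sum] at hT hE
    push Not at hT
    obtain ⟨m, h1, h2, h3⟩ := hT
    have : ∃ k, k ∉ E ∧ m k ≠ 0 := by
      by_contra! hc
      exact h3 (hE m hc h2)
    obtain ⟨k, hk, hk0⟩ := this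
    rcases lt_or_gt_of_ne hk0 with hneg | hpos
    · refine ⟨-m, fun i hi => by simp [h1 i hi], by simp [h2], k, hk, by simpa using hneg⟩
    · exact ⟨m, h1, h2, k, hk, hpos⟩
  -- Subtracting `l k / m k` times the dependency kills the coefficient at `k`; minimality of the
  -- ratio keeps the others outside `E` nonnegative.
  obtain ⟨k, hkmem, hkmin⟩ := Finset.exists_min_image
    (Finset.univ.filter fun i => i ∉ E ∧ 0 < m i) (fun i => l i / m i)
    ⟨k₀, by simp [hk₀E, hk₀]⟩
  simp only [Finset.mem_filter, Finset.mem_univ, true_and] at hkmem hkmin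
  obtain ⟨hkE, hkpos⟩ := hkmem
  have hkT : k ∈ T := by
    by_contra h
    exact hkpos.ne' (hmT k h)
  refine ⟨k, hkT, hkE, fun i => l i - l k / m k * m i, ?_, ?_, ?_⟩
  · intro i hi
    by_cases hik : i = k
    · subst hik
      field_simp
      ring
    · have : i ∉ T := fun h => hi ⟨h, hik⟩
      simp [hlT i this, hmT i this]
  · intro i hi
    have ht : 0 ≤ l k / m k := div_nonneg (hlE k hkE) hkpos.le
    rcases le_or_gt (m i) 0 with h0 | h0
    · have := mul_nonpos_of_nonneg_of_nonpos ht h0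
      linarith [hlE i hi]
    · have := hkmin i ⟨hi, h0⟩
      rw [le_div_iff₀ h0] at this
      linarith
  · simp only [sub_smul, Finset.sum_sub_distrib, mul_smul, ← Finset.smul_sum, hmsum, smul_zero,
      sub_zero]

/-- The coefficient vectors supported on `S`. -/
def coeffsOn (S : Set ι) : Submodule ℝ (ι → ℝ) where
  carrier := {l | ∀ i ∉ S, l i = 0}
  add_mem' h h' i hi := by simp [h i hi, h' i hi]
  zero_mem' i _ := rfl
  smul_mem' c l h i hi := by simp [h i hi]

theorem LinearIndepOn.injective_domRestrict_coeffsOn [AddCommGroup H] [Module ℝ H] {a : ι → H}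
    {S : Set ι} (hS : LinearIndepOn ℝ a S) :
    Function.Injective ((Fintype.linearCombination ℝ a).domRestrict (coeffsOn S)) := by
  rw [linearIndepOn_iff_forall_sum] at hS
  rw [injective_iff_map_eq_zero]
  rintro ⟨l, hl⟩ h
  exact Subtype.ext (hS l hl (by simpa [Fintype.linearCombination_apply] using h))

variable [NormedAddCommGroup H]

/-- Independence makes the coefficient map a closed embedding of a finite-dimensional space, and the
sign conditions cut out a closed set there. -/
theorem isClosed_conicSet_of_linearIndepOn [NormedSpace ℝ H] {a : ι → H} (E : Set ι) {S : Set ι}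
    (hS : LinearIndepOn ℝ a S) : IsClosed (conicSet a E S) := by
  have hemb := LinearMap.isClosedEmbedding_of_injective
    (LinearMap.ker_eq_bot.2 hS.injective_domRestrict_coeffsOn)
  have hc : IsClosed {l : coeffsOn S | ∀ i ∉ E, 0 ≤ (l : ι → ℝ) i} := by
    simp only [Set.ofPred_forall]
    exact isClosed_iInter fun i => isClosed_iInter fun _ =>
      isClosed_le continuous_const ((continuous_apply i).comp continuous_subtype_val)
  convert hemb.isClosedMap _ hc using 1
  ext z
  constructor
  · rintro ⟨l, h1, h2, rfl⟩
    exact ⟨⟨l, h1⟩, h2, by simp [Fintype.linearCombination_apply]⟩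
  · rintro ⟨⟨l, h1⟩, h2, rfl⟩
    exact ⟨l, h1, h2, by simp [Fintype.linearCombination_apply]⟩

/-- By Carathéodory's reduction the cone is a finite union of cones over independent subfamilies. -/
theorem isClosed_conicSet [NormedSpace ℝ H] {a : ι → H} {E T : Set ι} (hET : E ⊆ T)
    (hE : LinearIndepOn ℝ a E) : IsClosed (conicSet a E T) := by
  have h : conicSet a E T = ⋃ S ∈ {S : Set ι | S ⊆ T ∧ LinearIndepOn ℝ a S}, conicSet a E S := by
    ext z
    simp only [Set.mem_iUnion, Set.mem_ofPred_eq, exists_prop]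
    constructor
    · intro hz
      obtain ⟨S, -, h2, h3, h4⟩ := exists_linearIndepOn_conic a hET hE hz
      exact ⟨S, ⟨h2, h3⟩, h4⟩
    · rintro ⟨S, ⟨h2, -⟩, l, h3, h4, h5⟩
      exact ⟨l, fun i hi => h3 i fun h => hi (h2 h), h4, h5⟩
  rw [h]
  exact (Set.toFinite _).isClosed_biUnion fun S hS => isClosed_conicSet_of_linearIndepOn E hS.2

/-- Farkas' lemma for conic combinations with free coefficients on `E`. -/
theorem mem_conicSet_of_forall_inner_nonpos [InnerProductSpace ℝ H] [CompleteSpace H] {a : ι → H}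
    {E T : Set ι} (hET : E ⊆ T) (hE : LinearIndepOn ℝ a E) {z : H}
    (hz : ∀ h : H, (∀ i ∈ E, inner ℝ h (a i) = 0) → (∀ i ∈ T, inner ℝ h (a i) ≤ 0) →
      inner ℝ z h ≤ 0) : z ∈ conicSet a E T := by
  classical
  have hadd : ∀ u ∈ conicSet a E T, ∀ w ∈ conicSet a E T, ∀ s : ℝ, 0 ≤ s →
      ∀ t : ℝ, 0 ≤ t → s • u + t • w ∈ conicSet a E T := by
    rintro _ ⟨l, h1, h2, rfl⟩ _ ⟨m, h3, h4, rfl⟩ s hs t ht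
    refine ⟨s • l + t • m, fun i hi => by simp [h1 i hi, h3 i hi], fun i hi => ?_, ?_⟩
    · have := mul_nonneg hs (h2 i hi)
      have := mul_nonneg ht (h4 i hi)
      simp only [Pi.add_apply, Pi.smul_apply, smul_eq_mul]
      linarith
    · simp [add_smul, mul_smul, Finset.sum_add_distrib, Finset.smul_sum]
  have hsingle : ∀ i ∈ T, ∀ c : ℝ, (i ∉ E → 0 ≤ c) → c • a i ∈ conicSet a E T := by
    intro i hi c hc
    refine ⟨Pi.single i c, fun j hj => ?_, fun j hj => ?_, ?_⟩
    · exact Pi.single_eq_of_ne (by rintro rfl; exact hj hi) _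
    · by_cases hji : j = i
      · subst hji
        simpa using hc hj
      · simp [Pi.single_eq_of_ne hji]
    · simp [Pi.single_apply]
  have hzero : (0 : H) ∈ conicSet a E T := ⟨0, by simp, by simp, by simp⟩
  have hconv : Convex ℝ (conicSet a E T) := fun u hu w hw s t hs ht _ => hadd u hu w hw s hs t ht
  obtain ⟨y, hy, hmin⟩ := exists_norm_eq_iInf_of_complete_convex ⟨0, hzero⟩
    (isClosed_conicSet hET hE).isComplete hconv z
  have hvar := (norm_eq_iInf_iff_real_inner_le_zero hconv hy).1 hmin
  have hpol : ∀ w ∈ conicSet a E T, inner ℝ (z - y) w ≤ 0 := by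
    intro w hw
    have := hvar (y + w) (by simpa using hadd y hy w hw 1 zero_le_one 1 zero_le_one)
    simpa using this
  have hyy : 0 ≤ inner ℝ (z - y) y := by
    have := hvar 0 hzero
    simpa using this
  -- With `y` the projection of `z` onto the cone, `z - y` lies in the polar cone, so the hypothesis
  -- applies to it.
  have h1 : inner ℝ z (z - y) ≤ 0 := by
    refine hz (z - y) (fun i hi => le_antisymm ?_ ?_) fun i hi => ?_
    · simpa using hpol _ (hsingle i (hET hi) 1 (by simp))
    · simpa using hpol _ (hsingle i (hET hi) (-1) (fun h => absurd hi h))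
    · simpa using hpol _ (hsingle i hi 1 (by simp))
  have h2 : inner ℝ (z - y) (z - y) ≤ 0 := by
    rw [inner_sub_left, real_inner_comm (z - y) y]
    linarith
  have h3 : z - y = 0 := real_inner_self_nonpos.1 h2
  rwa [sub_eq_zero.1 h3]

/-- Hoffman's error bound for the system defining `feasibleSet E f g p`, with
an explicit constant. Here `B` indexes a basis of the span of the equality vectors. -/
theorem exists_mem_feasibleSet_norm_sub_le [InnerProductSpace ℝ H] [CompleteSpace H] {D : Type*}
    {f : ι → D → ℝ} {g : ι → D → H} {p : D} {E B : Set ι} (hBE : B ⊆ E)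
    (hB : LinearIndepOn ℝ (fun i => g i p) B)
    (hspan : ∀ i ∈ E, g i p ∈ Submodule.span ℝ ((fun i => g i p) '' B)) {c : ℝ} (hc0 : 0 ≤ c)
    (hc : ∀ S, B ⊆ S → LinearIndepOn ℝ (fun i => g i p) S →
      ∀ l : ι → ℝ, (∀ i ∉ S, l i = 0) → ‖l‖ ≤ c * ‖∑ i, l i • g i p‖)
    (hne : (feasibleSet E f g p).Nonempty) (x : H) {r : ℝ}
    (hr : ∀ i ∈ E, |inner ℝ x (g i p) - f i p| ≤ r)
    (hr' : ∀ i ∉ E, inner ℝ x (g i p) - f i p ≤ r) (hr0 : 0 ≤ r) :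
    ∃ y ∈ feasibleSet E f g p, ‖x - y‖ ≤ Fintype.card ι * c * r := by
  set C := feasibleSet E f g p with hC
  have hproj : IsProjection C x (metricProjection C x) :=
    (isProjection_feasibleSet_iff E f g p hne x _).2 rfl
  obtain ⟨y, hy⟩ : ∃ y, IsProjection C x y := ⟨_, hproj⟩
  refine ⟨y, hy.1, ?_⟩
  set T : Set ι := activeSet f g p y with hT
  have hET : E ⊆ T := fun i hi => hy.1.1 i hi
  -- The residual `x - y` is normal to `C` at `y`: a direction `h` admissible for the active
  -- constraints stays feasible for a small step, inactive ones being strict.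
  have hmem : x - y ∈ conicSet (fun i => g i p) B T := by
    refine mem_conicSet_of_forall_inner_nonpos (hBE.trans hET) hB fun h hhB hhT => ?_
    have hhE : ∀ i ∈ E, inner ℝ h (g i p) = 0 := by
      intro i hi
      have hle : Submodule.span ℝ ((fun i => g i p) '' B) ≤ (innerₛₗ ℝ h).ker := by
        rw [Submodule.span_le]
        rintro _ ⟨j, hj, rfl⟩
        simpa using hhB j hj
      simpa using hle (hspan i hi)
    obtain ⟨t, ht0, ht⟩ : ∃ t : ℝ, 0 < t ∧ ∀ i ∉ T, inner ℝ (y + t • h) (g i p) ≤ f i p := by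
      have hev : ∀ᶠ t : ℝ in 𝓝 0, ∀ i, i ∉ T → inner ℝ (y + t • h) (g i p) < f i p := by
        refine Filter.eventually_all.2 fun i => ?_
        by_cases hi : i ∈ T
        · simp [hi]
        have hlt : inner ℝ (y + (0 : ℝ) • h) (g i p) < f i p := by
          simpa using lt_of_le_of_ne (hy.1.2 i fun h => hi (hET h)) hi
        have hcont : Continuous fun t : ℝ => inner ℝ (y + t • h) (g i p) := by fun_prop
        filter_upwards [hcont.continuousAt.eventually_lt_const hlt] with t ht _ using ht
      have hev' := (hev.filter_mono nhdsWithin_le_nhds).and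
        (self_mem_nhdsWithin : Set.Ioi (0 : ℝ) ∈ 𝓝[>] 0)
      obtain ⟨t, h1, h2⟩ := hev'.exists
      exact ⟨t, h2, fun i hi => (h1 i hi).le⟩
    have hw : y + t • h ∈ C := by
      refine ⟨fun i hi => ?_, fun i hi => ?_⟩
      · rw [inner_add_left, real_inner_smul_left, hhE i hi, hy.1.1 i hi, mul_zero, add_zero]
      · by_cases hiT : i ∈ T
        · rw [inner_add_left, real_inner_smul_left]
          have := mul_nonpos_of_nonneg_of_nonpos ht0.le (hhT i hiT)
          have := hy.1.2 i hi
          linarith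
        · exact ht i hiT
    have := inner_sub_le_zero_of_isProjection hy hw
    rw [add_sub_cancel_left, real_inner_smul_right] at this
    exact nonpos_of_mul_nonpos_right this ht0
  obtain ⟨S, hBS, hST, hS, l, hl0, hlB, hl⟩ :=
    exists_linearIndepOn_conic _ (hBE.trans hET) hB hmem
  have hbound := hc S hBS hS l hl0
  simp only at hl
  rw [hl] at hbound
  have hterm : ∀ i, l i * inner ℝ (x - y) (g i p) ≤ ‖l‖ * r := by
    intro i
    by_cases hiT : i ∈ T
    swap
    · rw [hl0 i fun h => hiT (hST h), zero_mul]
      positivity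
    have hin : inner ℝ (x - y) (g i p) = inner ℝ x (g i p) - f i p := by
      rw [inner_sub_left, show inner ℝ y (g i p) = f i p from hiT]
    have hli : |l i| ≤ ‖l‖ := norm_le_pi_norm l i
    rw [hin]
    -- Coefficients on `B ⊆ E` have no sign, hence the two-sided residual bound on `E`; elsewhere `l
    -- i ≥ 0` and a one-sided bound is enough.
    by_cases hiE : i ∈ E
    · calc _ ≤ |l i * (inner ℝ x (g i p) - f i p)| := le_abs_self _
        _ = |l i| * |inner ℝ x (g i p) - f i p| := abs_mul _ _
        _ ≤ _ := mul_le_mul hli (hr i hiE) (abs_nonneg _) (norm_nonneg _)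
    · have h0 := hlB i fun h => hiE (hBE h)
      calc _ ≤ l i * r := mul_le_mul_of_nonneg_left (hr' i hiE) h0
        _ ≤ _ := mul_le_mul_of_nonneg_right ((le_abs_self _).trans hli) hr0
  have hsq : ‖x - y‖ * ‖x - y‖ ≤ (Fintype.card ι * c * r) * ‖x - y‖ := by
    calc ‖x - y‖ * ‖x - y‖ = inner ℝ (x - y) (∑ i, l i • g i p) := by
          rw [hl, real_inner_self_eq_norm_mul_norm]
      _ = ∑ i, l i * inner ℝ (x - y) (g i p) := by
          simp only [inner_sum, real_inner_smul_right]
      _ ≤ ∑ _i : ι, ‖l‖ * r := Finset.sum_le_sum fun i _ => hterm i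
      _ = Fintype.card ι * (‖l‖ * r) := by simp
      _ ≤ Fintype.card ι * ((c * ‖x - y‖) * r) := by gcongr
      _ = _ := by ring
  rcases (norm_nonneg (x - y)).eq_or_lt with h0 | h0
  · rw [← h0]
    positivity
  · exact le_of_mul_le_mul_right hsq h0

end ConicCombinations

/-! ### Stability of linear independence and a uniform Hoffman constant. -/

section ConstantRank

variable {ι H D : Type*} [NormedAddCommGroup H] [NormedSpace ℝ H]

theorem linearIndepOn_iff_finrank_image_eq_ncard [Finite ι] {V : Type*} [AddCommGroup V] [Module ℝ V] {a : ι → V}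
    {S : Set ι} : LinearIndepOn ℝ a S ↔ Set.finrank ℝ (a '' S) = S.ncard := by
  have := Fintype.ofFinite S
  rw [LinearIndepOn, linearIndependent_iff_card_eq_finrank_span, Set.range_comp', Subtype.range_coe,
    ← Nat.card_eq_fintype_card, Nat.card_coe_set_eq, eq_comm]

/-- Near a point where the vectors `g i p`, `i ∈ S`, are linearly independent, their coefficients
are uniformly controlled by the norms of their linear combinations. -/
theorem LinearIndepOn.exists_eventually_norm_le [Fintype ι] [TopologicalSpace D] {g : ι → D → H}
    {p₀ : D} (hg : ∀ i, ContinuousAt (g i) p₀) {S : Set ι}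
    (hS : LinearIndepOn ℝ (fun i => g i p₀) S) :
    ∃ c : ℝ, ∀ᶠ p in 𝓝 p₀, ∀ l : ι → ℝ, (∀ i ∉ S, l i = 0) →
      ‖l‖ ≤ c * ‖∑ i, l i • g i p‖ := by
  obtain ⟨K, hK0, hK⟩ := LinearMap.exists_antilipschitzWith _
    (LinearMap.ker_eq_bot.2 hS.injective_domRestrict_coeffsOn)
  have hK0' : (0 : ℝ) < K := hK0
  have hK' : ∀ l : ι → ℝ, (∀ i ∉ S, l i = 0) → ‖l‖ ≤ K * ‖∑ i, l i • g i p₀‖ := by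
    intro l hl
    have := hK.le_mul_norm_sub (x := (⟨l, hl⟩ : coeffsOn S)) (y := 0)
    simpa [Fintype.linearCombination_apply] using this
  have hcont : ContinuousAt (fun p => ∑ i, ‖g i p - g i p₀‖) p₀ :=
    tendsto_finsetSum _ fun i _ => ((hg i).sub continuousAt_const).norm
  -- This threshold makes the perturbation cost at most `‖l‖ / 2`, which is absorbed on the left.
  have hlt : ∑ i, ‖g i p₀ - g i p₀‖ < 1 / (2 * K) := by
    simp only [sub_self, norm_zero, Finset.sum_const_zero]
    positivity
  refine ⟨2 * K, ?_⟩
  filter_upwards [hcont.eventually_lt_const hlt] with p hp l hl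
  have h1 := hK' l hl
  have h2 : ‖∑ i, l i • g i p₀‖ ≤ ‖∑ i, l i • g i p‖ + ‖l‖ * (1 / (2 * K)) := by
    have h3 : ∑ i, l i • g i p₀ = ∑ i, l i • g i p - ∑ i, l i • (g i p - g i p₀) := by
      simp only [smul_sub, Finset.sum_sub_distrib]
      abel
    rw [h3]
    refine (norm_sub_le _ _).trans (add_le_add_right ?_ _)
    calc ‖∑ i, l i • (g i p - g i p₀)‖ ≤ ∑ i, ‖l i • (g i p - g i p₀)‖ := norm_sum_le _ _
      _ ≤ ∑ i, ‖l‖ * ‖g i p - g i p₀‖ := Finset.sum_le_sum fun i _ => by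
          rw [norm_smul]
          exact mul_le_mul_of_nonneg_right (norm_le_pi_norm l i) (norm_nonneg _)
      _ = ‖l‖ * ∑ i, ‖g i p - g i p₀‖ := by rw [Finset.mul_sum]
      _ ≤ _ := mul_le_mul_of_nonneg_left hp.le (norm_nonneg _)
  have h4 : ‖l‖ ≤ K * ‖∑ i, l i • g i p‖ + ‖l‖ / 2 := by
    calc ‖l‖ ≤ K * (‖∑ i, l i • g i p‖ + ‖l‖ * (1 / (2 * K))) :=
          h1.trans (mul_le_mul_of_nonneg_left h2 hK0'.le)
      _ = _ := by field_simp
  linarith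

theorem LinearIndepOn.of_forall_norm_le [Fintype ι] {a : ι → H} {S : Set ι} {c : ℝ}
    (h : ∀ l : ι → ℝ, (∀ i ∉ S, l i = 0) → ‖l‖ ≤ c * ‖∑ i, l i • a i‖) :
    LinearIndepOn ℝ a S := by
  rw [linearIndepOn_iff_forall_sum]
  intro l hl hsum
  have := h l hl
  rw [hsum, norm_zero, mul_zero] at this
  exact norm_le_zero_iff.1 this

/-- If the vectors with index in `E ∪ S` have the same rank for `a` and `a'`, and `S` contains a
set `B` with `a '' B` spanning `a '' E`, then independence of `a'` on `S` carries over to `a`. -/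
theorem LinearIndepOn.of_finrank_eq [Finite ι] {V : Type*} [AddCommGroup V] [Module ℝ V]
    {a a' : ι → V} {B E S : Set ι}
    (hspan : Submodule.span ℝ (a '' E) ≤ Submodule.span ℝ (a '' B)) (hBS : B ⊆ S)
    (hrank : Set.finrank ℝ (a' '' (E ∪ S)) = Set.finrank ℝ (a '' (E ∪ S)))
    (hS : LinearIndepOn ℝ a' S) : LinearIndepOn ℝ a S := by
  have := Fintype.ofFinite S
  have h1 : S.ncard ≤ Set.finrank ℝ (a '' (E ∪ S)) := by
    rw [← hrank, ← linearIndepOn_iff_finrank_image_eq_ncard.1 hS]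
    have : FiniteDimensional ℝ (Submodule.span ℝ (a' '' (E ∪ S))) :=
      FiniteDimensional.span_of_finite ℝ (Set.toFinite _)
    exact Submodule.finrank_mono (Submodule.span_mono (Set.image_mono Set.subset_union_right))
  have h2 : Set.finrank ℝ (a '' (E ∪ S)) ≤ Set.finrank ℝ (a '' S) := by
    have : FiniteDimensional ℝ (Submodule.span ℝ (a '' S)) :=
      FiniteDimensional.span_of_finite ℝ (Set.toFinite _)
    refine Submodule.finrank_mono ?_
    rw [Set.image_union, Submodule.span_union]
    exact sup_le (hspan.trans (Submodule.span_mono (Set.image_mono hBS))) le_rfl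
  rw [LinearIndepOn, linearIndependent_iff_card_le_finrank_span, Set.range_comp',
    Subtype.range_coe, ← Nat.card_eq_fintype_card, Nat.card_coe_set_eq]
  exact h1.trans h2

end ConstantRank

/-- Under the constant rank condition, Hoffman's error bound holds with a constant independent of
the parameter. -/
theorem exists_eventually_hoffman {ι H D : Type*} [Finite ι] [NormedAddCommGroup H]
    [InnerProductSpace ℝ H] [CompleteSpace H] [TopologicalSpace D] {E : Set ι} (f : ι → D → ℝ)
    {g : ι → D → H} {p₀ : D} (hg : ∀ i, ContinuousAt (g i) p₀)
    (hrank : ∀ᶠ p in 𝓝 p₀, ∀ J, E ⊆ J →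
      Set.finrank ℝ ((fun i => g i p) '' J) = Set.finrank ℝ ((fun i => g i p₀) '' J)) :
    ∃ c : ℝ, 0 ≤ c ∧ ∀ᶠ p in 𝓝 p₀, (feasibleSet E f g p).Nonempty → ∀ x : H, ∀ r : ℝ, 0 ≤ r →
      (∀ i ∈ E, |inner ℝ x (g i p) - f i p| ≤ r) → (∀ i ∉ E, inner ℝ x (g i p) - f i p ≤ r) →
      ∃ y ∈ feasibleSet E f g p, ‖x - y‖ ≤ c * r := by
  have := Fintype.ofFinite ι
  obtain ⟨B, hBE, -, hEB, hB⟩ := exists_linearIndepOn_extension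
    (linearIndepOn_empty ℝ fun i => g i p₀) (Set.empty_subset E)
  have hunif : ∀ S : Set ι, ∃ c : ℝ, LinearIndepOn ℝ (fun i => g i p₀) S →
      ∀ᶠ p in 𝓝 p₀, ∀ l : ι → ℝ, (∀ i ∉ S, l i = 0) → ‖l‖ ≤ c * ‖∑ i, l i • g i p‖ := by
    intro S
    by_cases hS : LinearIndepOn ℝ (fun i => g i p₀) S
    · obtain ⟨c, hc⟩ := hS.exists_eventually_norm_le hg
      exact ⟨c, fun _ => hc⟩
    · exact ⟨0, fun h => absurd h hS⟩
  choose c hc using hunif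
  obtain ⟨M, hM⟩ := (Set.finite_range c).bddAbove
  refine ⟨Fintype.card ι * max M 0, by positivity, ?_⟩
  have hall : ∀ᶠ p in 𝓝 p₀, ∀ S : Set ι, LinearIndepOn ℝ (fun i => g i p₀) S →
      ∀ l : ι → ℝ, (∀ i ∉ S, l i = 0) → ‖l‖ ≤ c S * ‖∑ i, l i • g i p‖ := by
    refine Filter.eventually_all.2 fun S => ?_
    by_cases hS : LinearIndepOn ℝ (fun i => g i p₀) S
    · filter_upwards [hc S hS] with p hp _ using hp
    · exact Filter.Eventually.of_forall fun p h => absurd h hS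
  filter_upwards [hall, hrank] with p hp hrk hne x r hr0 hr hr'
  have hBp : LinearIndepOn ℝ (fun i => g i p) B := .of_forall_norm_le (hp B hB)
  -- `B` stays independent near `p₀` while the rank on `E` stays `B.ncard`, so `B` still spans.
  have hspan : Submodule.span ℝ ((fun i => g i p) '' B)
      = Submodule.span ℝ ((fun i => g i p) '' E) := by
    have : FiniteDimensional ℝ (Submodule.span ℝ ((fun i => g i p) '' E)) :=
      FiniteDimensional.span_of_finite ℝ (Set.toFinite _)
    refine Submodule.eq_of_le_of_finrank_le (Submodule.span_mono (Set.image_mono hBE)) ?_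
    change Set.finrank ℝ _ ≤ Set.finrank ℝ _
    rw [hrk E subset_rfl, linearIndepOn_iff_finrank_image_eq_ncard.1 hBp, ← linearIndepOn_iff_finrank_image_eq_ncard.1 hB]
    have : FiniteDimensional ℝ (Submodule.span ℝ ((fun i => g i p₀) '' B)) :=
      FiniteDimensional.span_of_finite ℝ (Set.toFinite _)
    exact Submodule.finrank_mono (Submodule.span_le.2 hEB)
  refine exists_mem_feasibleSet_norm_sub_le hBE hBp (fun i hi => ?_) (le_max_right _ _)
    (fun S hBS hS l hl => ?_) hne x hr hr' hr0
  · rw [hspan]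
    exact Submodule.subset_span ⟨i, hi, rfl⟩
  -- Constant rank on `E ∪ S` carries independence from `p` back to `p₀`, where the bound `c S` was
  -- fixed in advance.
  · have hS₀ : LinearIndepOn ℝ (fun i => g i p₀) S :=
      .of_finrank_eq (Submodule.span_le.2 hEB) hBS (hrk _ Set.subset_union_left) hS
    exact (hp S hS₀ l hl).trans (mul_le_mul_of_nonneg_right
      ((hM ⟨S, rfl⟩).trans (le_max_left _ _)) (norm_nonneg _))

/-! ### Lipschitz dependence of the feasible set on the parameter. -/

/-- Finitely many locally Lipschitz maps share a Lipschitz constant near a given point. -/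
theorem exists_lipschitz_nhds {ι D F : Type*} [Finite ι] [PseudoMetricSpace D]
    [SeminormedAddCommGroup F] {f : ι → D → F} (hf : ∀ i, LocallyLipschitz (f i)) (p₀ : D) :
    ∃ L : ℝ, 0 ≤ L ∧ ∃ U ∈ 𝓝 p₀, ∀ p ∈ U, ∀ q ∈ U, ∀ i, ‖f i p - f i q‖ ≤ L * dist p q := by
  choose K t ht hK using fun i => hf i p₀
  obtain ⟨M, hM⟩ := (Set.finite_range K).bddAbove
  refine ⟨M, M.2, ⋂ i, t i, Filter.iInter_mem.2 ht, fun p hp q hq i => ?_⟩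
  rw [← dist_eq_norm]
  refine ((hK i).dist_le_mul p (Set.mem_iInter.1 hp i) q (Set.mem_iInter.1 hq i)).trans ?_
  exact mul_le_mul_of_nonneg_right (NNReal.coe_le_coe.2 (hM ⟨i, rfl⟩)) dist_nonneg

/-- The constraints that are inactive at `x₀` hold with a uniform slack near `(x₀, p₀)`. -/
theorem exists_eventually_slack {ι H D : Type*} [Finite ι] [NormedAddCommGroup H]
    [InnerProductSpace ℝ H] [TopologicalSpace D] {I₁ : Set ι} {f : ι → D → ℝ} {g : ι → D → H}
    {p₀ : D} {x₀ : H} (hf : ∀ i, ContinuousAt (f i) p₀) (hg : ∀ i, ContinuousAt (g i) p₀)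
    (hx : x₀ ∈ feasibleSet I₁ f g p₀) :
    ∃ δ : ℝ, 0 < δ ∧ ∃ V ∈ 𝓝 x₀, ∃ U ∈ 𝓝 p₀, ∀ u ∈ V, ∀ p ∈ U, ∀ i ∉ activeSet f g p₀ x₀,
      inner ℝ u (g i p) + δ ≤ f i p := by
  have hslack : ∀ i, i ∉ activeSet f g p₀ x₀ → 0 < f i p₀ - inner ℝ x₀ (g i p₀) := by
    intro i hi
    exact sub_pos.2 (lt_of_le_of_ne (hx.2 i fun h => hi (hx.1 i h)) hi)
  have hev : ∀ᶠ δ : ℝ in 𝓝 0, ∀ i, i ∉ activeSet f g p₀ x₀ →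
      δ < f i p₀ - inner ℝ x₀ (g i p₀) := by
    refine Filter.eventually_all.2 fun i => ?_
    by_cases hi : i ∈ activeSet f g p₀ x₀
    · simp [hi]
    · filter_upwards [eventually_lt_nhds (hslack i hi)] with δ h _ using h
  obtain ⟨δ, h1, h2⟩ := ((hev.filter_mono nhdsWithin_le_nhds).and
    (self_mem_nhdsWithin : Set.Ioi (0 : ℝ) ∈ 𝓝[>] 0)).exists
  have hprod : ∀ᶠ z : H × D in 𝓝 x₀ ×ˢ 𝓝 p₀, ∀ i, i ∉ activeSet f g p₀ x₀ →
      δ < f i z.2 - inner ℝ z.1 (g i z.2) := by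
    refine Filter.eventually_all.2 fun i => ?_
    by_cases hi : i ∈ activeSet f g p₀ x₀
    · simp [hi]
    have hc : Filter.Tendsto (fun z : H × D => f i z.2 - inner ℝ z.1 (g i z.2))
        (𝓝 x₀ ×ˢ 𝓝 p₀) (𝓝 (f i p₀ - inner ℝ x₀ (g i p₀))) :=
      ((hf i).tendsto.comp Filter.tendsto_snd).sub
        (Filter.tendsto_fst.inner ((hg i).tendsto.comp Filter.tendsto_snd))
    filter_upwards [hc.eventually_const_lt (h1 i hi)] with z hz _ using hz
  obtain ⟨V, hV, U, hU, hVU⟩ := Filter.mem_prod_iff.1 hprod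
  refine ⟨δ, h2, V, hV, U, hU, fun u hu p hp i hi => ?_⟩
  have := hVU (Set.mk_mem_prod hu hp) i hi
  simp only at this
  linarith

/-- Under the relaxed constant rank condition, `p ↦ C(p)` is Lipschitz on bounded sets near `p₀`. -/
theorem exists_lipschitz_feasibleSet {ι H D : Type*} [Finite ι] [NormedAddCommGroup H]
    [InnerProductSpace ℝ H] [CompleteSpace H] [PseudoMetricSpace D] {I₁ : Set ι} {f : ι → D → ℝ}
    {g : ι → D → H} (hf : ∀ i, LocallyLipschitz (f i)) (hg : ∀ i, LocallyLipschitz (g i))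
    {p₀ : D} {x₀ : H} (hx : x₀ ∈ feasibleSet I₁ f g p₀) (hR : RCRCQ I₁ f g p₀ x₀)
    (hK : x₀ ∈ lowerKuratowskiLimit (feasibleSet I₁ f g) p₀) {R : ℝ} (hR0 : 0 ≤ R) :
    ∃ ℓ : ℝ, 0 ≤ ℓ ∧ ∃ U ∈ 𝓝 p₀, ∀ p ∈ U, ∀ q ∈ U, ∀ x ∈ feasibleSet I₁ f g p, ‖x‖ ≤ R →
      ∃ y ∈ feasibleSet I₁ f g q, ‖x - y‖ ≤ ℓ * dist p q := by
  set A := activeSet f g p₀ x₀ with hA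
  have hIA : ∀ i ∈ I₁, i ∈ A := fun i hi => hx.1 i hi
  have hcf := fun i => (hf i).continuous.continuousAt (x := p₀)
  have hcg := fun i => (hg i).continuous.continuousAt (x := p₀)
  -- `C'` keeps only the constraints active at `x₀`, the ones whose ranks RCRCQ controls.
  set E : Set A := Subtype.val ⁻¹' I₁ with hE
  set C' := feasibleSet E (fun i : A => f i) (fun i : A => g i) with hC'
  have hsub : ∀ p, feasibleSet I₁ f g p ⊆ C' p := fun p x hxp =>
    ⟨fun i hi => hxp.1 i hi, fun i hi => hxp.2 i hi⟩
  obtain ⟨c, hc0, hc⟩ := exists_eventually_hoffman (E := E) (fun i : A => f i)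
    (g := fun i : A => g i) (p₀ := p₀) (fun i => hcg i) (by
      obtain ⟨U, hU, h⟩ := hR
      filter_upwards [hU] with p hp J hJ
      have := h (Subtype.val '' J) (fun i hi => ⟨⟨i, hIA i hi⟩, hJ hi, rfl⟩)
        (by rintro _ ⟨i, -, rfl⟩; exact i.2) p hp
      rwa [Set.image_image, Set.image_image] at this)
  obtain ⟨L₁, hL₁, U₁, hU₁, hlf⟩ := exists_lipschitz_nhds hf p₀
  obtain ⟨L₂, hL₂, U₂, hU₂, hlg⟩ := exists_lipschitz_nhds hg p₀
  obtain ⟨δ, hδ, V, hV, U₃, hU₃, hslack⟩ := exists_eventually_slack hcf hcg hx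
  obtain ⟨U₄, hU₄, hmeet⟩ := hK _ (Filter.inter_mem hV (Metric.ball_mem_nhds x₀ one_pos))
  obtain ⟨b, hb⟩ := (Set.finite_range fun i => ‖g i p₀‖).bddAbove
  have hbdd : ∀ᶠ q in 𝓝 p₀, ∀ i, ‖g i q‖ ≤ max b 0 + 1 := by
    refine Filter.eventually_all.2 fun i => ?_
    have hlt : ‖g i p₀‖ < max b 0 + 1 :=
      ((hb ⟨i, rfl⟩).trans (le_max_left _ _)).trans_lt (lt_add_one _)
    exact ((hcg i).norm.eventually_lt_const hlt).mono fun _ h => h.le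
  set M := max b 0 + 1 with hM
  have hM0 : 0 ≤ M := by positivity
  set ρ := R * L₂ + L₁ with hρ
  have hρ0 : 0 ≤ ρ := by positivity
  set σ := ρ + c * ρ * M with hσ
  have hσ0 : 0 ≤ σ := by positivity
  set N := ‖x₀‖ + 1 + R + c * ρ with hN
  have hN0 : 0 ≤ N := by positivity
  refine ⟨c * ρ + σ / δ * N, by positivity,
    U₁ ∩ U₂ ∩ U₃ ∩ U₄ ∩ {q | ∀ i, ‖g i q‖ ≤ M} ∩ {q | (C' q).Nonempty → ∀ x : H, ∀ r : ℝ, 0 ≤ r →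
      (∀ i ∈ E, |inner ℝ x (g i q) - f i q| ≤ r) → (∀ i ∉ E, inner ℝ x (g i q) - f i q ≤ r) →
      ∃ y ∈ C' q, ‖x - y‖ ≤ c * r} ∩ Metric.ball p₀ (1 / 2), ?_, ?_⟩
  · exact Filter.inter_mem (Filter.inter_mem (Filter.inter_mem (Filter.inter_mem (Filter.inter_mem
      (Filter.inter_mem hU₁ hU₂) hU₃) hU₄) hbdd) hc) (Metric.ball_mem_nhds _ (by norm_num))
  rintro p ⟨⟨⟨⟨⟨⟨hp1, hp2⟩, -⟩, -⟩, -⟩, -⟩, hp7⟩ q ⟨⟨⟨⟨⟨⟨hq1, hq2⟩, hq3⟩, hq4⟩, hq5⟩, hq6⟩, hq7⟩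
    x hxp hxR
  set d := dist p q with hd
  have hd0 : 0 ≤ d := dist_nonneg
  have hd1 : d ≤ 1 := by
    have := dist_triangle_right p q p₀
    have h1 := Metric.mem_ball.1 hp7
    have h2 := Metric.mem_ball.1 hq7
    linarith
  obtain ⟨u, ⟨huV, hu1⟩, huC⟩ := hmeet q hq4
  have hunorm : ‖u‖ ≤ ‖x₀‖ + 1 := by
    have h1 : ‖u - x₀‖ < 1 := by simpa [dist_eq_norm] using hu1
    have h2 := norm_le_norm_add_norm_sub' u x₀
    linarith
  have hdiff : ∀ i, |(inner ℝ x (g i q) - f i q) - (inner ℝ x (g i p) - f i p)| ≤ ρ * d := by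
    intro i
    have h1 : (inner ℝ x (g i q) - f i q) - (inner ℝ x (g i p) - f i p)
        = (f i p - f i q) - inner ℝ x (g i p - g i q) := by
      rw [inner_sub_right]
      ring
    rw [h1]
    have h2 := hlf p hp1 q hq1 i
    have h3 : |inner ℝ x (g i p - g i q)| ≤ R * (L₂ * d) :=
      (abs_real_inner_le_norm _ _).trans
        (mul_le_mul hxR (hlg p hp2 q hq2 i) (norm_nonneg _) hR0)
    rw [Real.norm_eq_abs] at h2
    calc _ ≤ |f i p - f i q| + |inner ℝ x (g i p - g i q)| := abs_sub _ _
      _ ≤ L₁ * d + R * (L₂ * d) := add_le_add h2 h3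
      _ = _ := by rw [hρ]; ring
  have hviol : ∀ i, inner ℝ x (g i q) - f i q ≤ ρ * d := by
    intro i
    have h1 := (abs_le.1 (hdiff i)).2
    have h2 : inner ℝ x (g i p) ≤ f i p := by
      by_cases hi : i ∈ I₁
      · exact (hxp.1 i hi).le
      · exact hxp.2 i hi
    linarith
  -- The point `y` satisfies the active constraints at `q`, but may violate the inactive ones by up
  -- to `σ * d`.
  obtain ⟨y, hyC, hyx⟩ := hq6 ⟨u, hsub q huC⟩ x (ρ * d) (by positivity)
    (fun i hi => by simpa [hxp.1 i hi] using hdiff i) fun i _ => hviol i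
  have hynorm : ‖y - u‖ ≤ N := by
    have h1 : ‖y - u‖ ≤ ‖x - y‖ + ‖x - u‖ := by
      rw [norm_sub_rev x y]
      exact norm_sub_le_norm_sub_add_norm_sub y x u
    have h2 := norm_sub_le x u
    have h3 : c * (ρ * d) ≤ c * ρ := by
      rw [← mul_assoc]
      exact mul_le_of_le_one_right (by positivity) hd1
    linarith
  have hyviol : ∀ i, inner ℝ y (g i q) - f i q ≤ σ * d := by
    intro i
    have h1 : inner ℝ y (g i q) = inner ℝ x (g i q) - inner ℝ (x - y) (g i q) := by
      rw [inner_sub_left]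
      ring
    have h2 : |inner ℝ (x - y) (g i q)| ≤ c * (ρ * d) * M :=
      (abs_real_inner_le_norm _ _).trans
        (mul_le_mul hyx (hq5 i) (norm_nonneg _) (by positivity))
    have h3 := (abs_le.1 h2).1
    have h4 := hviol i
    have h5 : σ * d = ρ * d + c * (ρ * d) * M := by rw [hσ]; ring
    linarith
  set s := σ * d with hs
  have hs0 : 0 ≤ s := by positivity
  -- This weight balances the violation `s` at `y` against the slack `δ` at `u`; it is `O(d)`, so
  -- the correction remains Lipschitz.
  set t := s / (s + δ) with ht
  have ht0 : 0 ≤ t := by positivity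
  have ht1 : t ≤ 1 := div_le_one_of_le₀ (by linarith) (by positivity)
  have htδ : t ≤ s / δ := div_le_div_of_nonneg_left hs0 hδ (by linarith)
  have hts : (1 - t) * s = t * δ := by
    rw [ht]
    field_simp
    ring
  have hwC : (1 - t) • y + t • u ∈ C' q :=
    convex_feasibleSet _ _ _ _ hyC (hsub q huC) (by linarith) ht0 (by ring)
  refine ⟨(1 - t) • y + t • u, ⟨fun i hi => hwC.1 ⟨i, hIA i hi⟩ hi, fun i hi => ?_⟩, ?_⟩
  · by_cases hiA : i ∈ A
    · exact hwC.2 ⟨i, hiA⟩ hi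
    · rw [inner_add_left, real_inner_smul_left, real_inner_smul_left]
      have h1 := mul_le_mul_of_nonneg_left (hyviol i) (sub_nonneg.2 ht1)
      have h2 := mul_le_mul_of_nonneg_left (hslack u huV q hq3 i hiA) ht0
      nlinarith
  · have h1 : x - ((1 - t) • y + t • u) = (x - y) + t • (y - u) := by
      module
    rw [h1]
    calc _ ≤ ‖x - y‖ + t * ‖y - u‖ := (norm_add_le _ _).trans_eq (by
          rw [norm_smul, Real.norm_of_nonneg ht0])
      _ ≤ c * (ρ * d) + s / δ * N :=
          add_le_add hyx (mul_le_mul htδ hynorm (norm_nonneg _) (by positivity))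
      _ = _ := by rw [hs]; ring

/-! ### Comparison of projections onto two nearby sets. -/

/-- Approximate firm nonexpansiveness of two projections whose target points are mutually within
`η` of the other target set. -/
theorem norm_sub_two_smul_sub_sq_le {H : Type*} [NormedAddCommGroup H] [InnerProductSpace ℝ H]
    {v₁ v₂ x₁ x₂ y₁ y₂ : H} {m η : ℝ} (h₁ : inner ℝ (v₁ - x₁) (y₂ - x₁) ≤ 0)
    (h₂ : inner ℝ (v₂ - x₂) (y₁ - x₂) ≤ 0) (hy₁ : ‖x₁ - y₁‖ ≤ η) (hy₂ : ‖x₂ - y₂‖ ≤ η)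
    (hm₁ : ‖v₁ - x₁‖ ≤ m) (hm₂ : ‖v₂ - x₂‖ ≤ m) :
    ‖(v₁ - v₂) - (2 : ℝ) • (x₁ - x₂)‖ ^ 2 ≤ ‖v₁ - v₂‖ ^ 2 + 8 * (m * η) := by
  have hm : 0 ≤ m := (norm_nonneg _).trans hm₁
  have h3 : inner ℝ (v₁ - x₁) (x₂ - y₂) ≤ m * η :=
    (real_inner_le_norm _ _).trans (mul_le_mul hm₁ hy₂ (norm_nonneg _) hm)
  have h4 : inner ℝ (v₂ - x₂) (x₁ - y₁) ≤ m * η :=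
    (real_inner_le_norm _ _).trans (mul_le_mul hm₂ hy₁ (norm_nonneg _) hm)
  have h5 : inner ℝ (v₁ - x₁) (x₂ - x₁) ≤ m * η := by
    have : x₂ - x₁ = (y₂ - x₁) + (x₂ - y₂) := by abel
    rw [this, inner_add_right]
    linarith
  have h6 : inner ℝ (v₂ - x₂) (x₁ - x₂) ≤ m * η := by
    have : x₁ - x₂ = (y₁ - x₂) + (x₁ - y₁) := by abel
    rw [this, inner_add_right]
    linarith
  have h7 : ‖x₁ - x₂‖ ^ 2 - inner ℝ (v₁ - v₂) (x₁ - x₂)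
      = inner ℝ (v₁ - x₁) (x₂ - x₁) + inner ℝ (v₂ - x₂) (x₁ - x₂) := by
    rw [← real_inner_self_eq_norm_sq]
    simp only [inner_sub_left, inner_sub_right]
    ring
  rw [norm_sub_sq_real, real_inner_smul_right, norm_smul, Real.norm_of_nonneg zero_le_two]
  nlinarith

theorem corollary2p3 {H G ι : Type*}
    [NormedAddCommGroup H] [InnerProductSpace ℝ H] [CompleteSpace H]
    [NormedAddCommGroup G] [NormedSpace ℝ G] [Finite ι]
    (D : Set G) (I₁ : Set ι) (f : ι → D → ℝ) (g : ι → D → H)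
    (hf : ∀ i, LocallyLipschitz (f i)) (hg : ∀ i, LocallyLipschitz (g i))
    (pbar : D) (xbar vbar : H)
    (hx : xbar ∈ feasibleSet I₁ f g pbar)
    (hR : RCRCQ I₁ f g pbar xbar)
    (hK : xbar ∈ lowerKuratowskiLimit (feasibleSet I₁ f g) pbar) :
    ∃ l₀ : ℝ, 0 < l₀ ∧ ∃ W ∈ 𝓝 vbar, ∃ U ∈ 𝓝 pbar,
      (∀ p ∈ U, (feasibleSet I₁ f g p).Nonempty) ∧
      ∀ v₁ ∈ W, ∀ v₂ ∈ W, ∀ p₁ ∈ U, ∀ p₂ ∈ U,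
        ‖(v₁ - v₂) - (2 : ℝ) • (projMap I₁ f g v₁ p₁ - projMap I₁ f g v₂ p₂)‖
          ≤ ‖v₁ - v₂‖ + l₀ * ‖(p₁ : G) - (p₂ : G)‖ ^ (1 / 2 : ℝ) := by
  -- Every `C(p)` meets the unit ball about `xbar`, so for `v` in the unit ball about `vbar` its
  -- distance to `C(p)` is at most `m`, and the projection has norm at most `R`.
  set m := ‖vbar‖ + 1 + (‖xbar‖ + 1) with hm
  set R := ‖vbar‖ + 1 + m with hRdef
  obtain ⟨ℓ, hℓ, U₁, hU₁, hlip⟩ := exists_lipschitz_feasibleSet hf hg hx hR hK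
    (show 0 ≤ R by positivity)
  obtain ⟨U₂, hU₂, hmeet⟩ := hK _ (Metric.ball_mem_nhds xbar one_pos)
  have hproj : ∀ v ∈ Metric.ball vbar 1, ∀ p ∈ U₂,
      IsProjection (feasibleSet I₁ f g p) v (projMap I₁ f g v p) ∧
      ‖v - projMap I₁ f g v p‖ ≤ m ∧ ‖projMap I₁ f g v p‖ ≤ R := by
    intro v hv p hp
    obtain ⟨u, hu, huC⟩ := hmeet p hp
    have hP := (isProjection_feasibleSet_iff I₁ f g p ⟨u, huC⟩ v _).2 rfl
    have hvn : ‖v‖ ≤ ‖vbar‖ + 1 := by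
      have h1 : ‖v - vbar‖ < 1 := by simpa [dist_eq_norm] using hv
      have h2 := norm_le_norm_add_norm_sub' v vbar
      linarith
    have hun : ‖u‖ ≤ ‖xbar‖ + 1 := by
      have h1 : ‖u - xbar‖ < 1 := by simpa [dist_eq_norm] using hu
      have h2 := norm_le_norm_add_norm_sub' u xbar
      linarith
    have hPm : ‖projMap I₁ f g v p - v‖ ≤ m := by
      have h1 : ‖projMap I₁ f g v p - v‖ ≤ ‖u - v‖ := hP.2 u huC
      have h2 := norm_sub_le u v
      linarith
    refine ⟨hP, by rwa [norm_sub_rev], ?_⟩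
    have h2 := norm_le_norm_add_norm_sub' (projMap I₁ f g v p) v
    linarith
  -- The summand 1 only secures positivity when `ℓ = 0`.
  refine ⟨√(8 * (m * ℓ)) + 1, by positivity, Metric.ball vbar 1, Metric.ball_mem_nhds _ one_pos,
    U₁ ∩ U₂, Filter.inter_mem hU₁ hU₂, fun p hp => (hmeet p hp.2).mono Set.inter_subset_right, ?_⟩
  intro v₁ hv₁ v₂ hv₂ p₁ hp₁ p₂ hp₂
  obtain ⟨hP₁, hm₁, hR₁⟩ := hproj v₁ hv₁ p₁ hp₁.2
  obtain ⟨hP₂, hm₂, hR₂⟩ := hproj v₂ hv₂ p₂ hp₂.2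
  obtain ⟨y₁, hy₁C, hy₁⟩ := hlip p₁ hp₁.1 p₂ hp₂.1 _ hP₁.1 hR₁
  obtain ⟨y₂, hy₂C, hy₂⟩ := hlip p₂ hp₂.1 p₁ hp₁.1 _ hP₂.1 hR₂
  rw [dist_comm p₂ p₁] at hy₂
  have key := norm_sub_two_smul_sub_sq_le (inner_sub_le_zero_of_isProjection hP₁ hy₂C)
    (inner_sub_le_zero_of_isProjection hP₂ hy₁C) hy₁ hy₂ hm₁ hm₂
  rw [← Real.sqrt_eq_rpow, ← dist_eq_norm (p₁ : G) (p₂ : G), ← Subtype.dist_eq]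
  refine abs_le_of_sq_le_sq' (key.trans ?_) (by positivity) |>.2
  set d := dist p₁ p₂ with hd
  have hd0 : 0 ≤ d := dist_nonneg
  have hs : √(8 * (m * ℓ)) ^ 2 = 8 * (m * ℓ) := Real.sq_sqrt (by positivity)
  have hds : √d ^ 2 = d := Real.sq_sqrt hd0
  calc ‖v₁ - v₂‖ ^ 2 + 8 * (m * (ℓ * d)) = ‖v₁ - v₂‖ ^ 2 + (√(8 * (m * ℓ)) * √d) ^ 2 := by
        rw [mul_pow, hs, hds]
        ring
    _ ≤ (‖v₁ - v₂‖ + √(8 * (m * ℓ)) * √d) ^ 2 := by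
        have : 0 ≤ ‖v₁ - v₂‖ * (√(8 * (m * ℓ)) * √d) := by positivity
        nlinarith
    _ ≤ _ := by
        gcongr
        linarith
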